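/- Let $p$ be a prime, let $l\ge 1$, $k\ge 1$ and $n\ge 2$ be integers, and put $q=p^l$ and $d=\gcd(k,q-1)$. Let $M_{n,q}$ be the ring of $n\times n$ matrices over the field $\mathbb F_q$ with $q$ elements, with zero element $0_n$. Put $$P=\{A^k+B^k : A,B\in M_{n,q}\},\qquad Q=\{A^k+B^k : A,B\in GL_n(\mathbb F_q)\},$$ and, for $S\subseteq M_{n,q}$, put $L_S=\{h\in GL_n(\mathbb F_q) : hS=S\}$, where $hS=\{hA : A\in S\}$. Assume that $(n,q)\notin\{(2,2),(2,3)\}$, and let $g$ be an element of $SL_n(\mathbb F_q)$ that is not in the center of $SL_n(\mathbb F_q)$. Then: (a) $P=M_{n,q}$ if and only if $g\in L_P$. (b) If $p\nmid k$ and $-1$ is a $d$-th power of an element of $\mathbb F_q$, then $Q=M_{n,q}$ if and only if $g\in L_Q$. (c) If $p\nmid k$, then $Q\cup\{0_n\}=M_{n,q}$ if and only if $g\in L_Q$. -/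

import Mathlib

namespace MatrixWaring

open scoped MatrixGroups

/-- The set of all `k`-th powers of elements of `M`. -/
def kthPowers (k : ℕ) (M : Type*) [Monoid M] : Set M :=
  {x | ∃ a : M, x = a ^ k}

/-- The set of all sums `A ^ k + B ^ k` of two `k`-th powers of `n × n` matrices over `F`. -/
def sumPowers (k n : ℕ) (F : Type*) [Field F] : Set (Matrix (Fin n) (Fin n) F) :=
  {X | ∃ A B : Matrix (Fin n) (Fin n) F, X = A ^ k + B ^ k}

/-- The set of all sums `A ^ k + B ^ k` of two `k`-th powers of invertible `n × n` matrices
over `F`. -/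
def sumUnitPowers (k n : ℕ) (F : Type*) [Field F] : Set (Matrix (Fin n) (Fin n) F) :=
  {X | ∃ A B : GL (Fin n) F,
    X = (A : Matrix (Fin n) (Fin n) F) ^ k + (B : Matrix (Fin n) (Fin n) F) ^ k}

/-- The subgroup of all `g` in the general linear group with `g S = S`, where
`g S = {g A | A ∈ S}`. -/
def leftStabilizer {n : ℕ} {F : Type*} [Field F] (S : Set (Matrix (Fin n) (Fin n) F)) :
    Subgroup (GL (Fin n) F) where
  carrier := {g | (fun A => (g : Matrix (Fin n) (Fin n) F) * A) '' S = S}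
  one_mem' := by simp
  mul_mem' := by
    intro a b ha hb
    simp only [Set.mem_ofPred_eq] at ha hb ⊢
    conv_rhs => rw [← ha, ← hb, Set.image_image]
    simp [mul_assoc]
  inv_mem' := by
    intro a ha
    simp only [Set.mem_ofPred_eq] at ha ⊢
    conv_lhs => rw [← ha, Set.image_image]
    have h : ∀ A : Matrix (Fin n) (Fin n) F,
        ((a⁻¹ : GL (Fin n) F) : Matrix (Fin n) (Fin n) F) * (a * A) = A :=
      fun A => Units.inv_mul_cancel_left a A
    simp only [h, Set.image_id']

end MatrixWaring

/-!
For a set `S` of matrices that is stable under conjugation, the left stabilizer of `S` is a normal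
subgroup of the general linear group. Outside the two exceptional cases every normal subgroup of
the special linear group that is not central is the whole group (Iwasawa's criterion for the
action on lines), so a single noncentral `g` in the left stabilizer forces `x S = S` for every `x`
of determinant one and, by conjugation, `S x = S` as well. It then suffices that every matrix `X`
is equivalent, under multiplication on both sides by matrices of determinant one, to an element
of `S`.

* For sums of `k`-th powers, `X` is equivalent to a sum of two idempotents.
* For sums of `k`-th powers of invertible matrices, `X ≠ 0` is equivalent to a matrix all of whose
  diagonal entries are `2`, that is, to `(1 + N) + (1 + N')` with `N` strictly upper and `N'`
  strictly lower triangular. A unipotent matrix is a `k`-th power when `k` is invertible in the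
  field.
-/

namespace MatrixWaring

open Matrix Matrix.SpecialLinearGroup
open scoped MatrixGroups LinearAlgebra.Projectivization commutatorElement

section SpecialLinearGroup

variable {ι R F : Type*} [Fintype ι] [DecidableEq ι] [CommRing R] [Field F]

lemma diagonal_mul_single {α : Type*} [NonUnitalNonAssocSemiring α] (d : ι → α) (i j : ι)
    (c : α) : diagonal d * single i j c = single i j (d i * c) := by
  ext r s
  simp only [diagonal_mul, single_apply, mul_ite, mul_zero]
  grind

lemma single_mul_diagonal {α : Type*} [NonUnitalNonAssocSemiring α] (d : ι → α) (i j : ι)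
    (c : α) : single i j c * diagonal d = single i j (c * d j) := by
  ext r s
  simp only [mul_diagonal, single_apply, ite_mul, zero_mul]
  grind

lemma diag2n_eq_one_add {i j : ι} (hij : i ≠ j) {a : F} (ha : a ≠ 0) :
    (diag2n hij a ha).1 = 1 + single i i (a - 1) + single j j (a⁻¹ - 1) := by
  rw [diag2n_coe]
  ext r s
  simp only [diagonal_apply, Matrix.add_apply, one_apply, single_apply]
  grind

lemma diag2n_eq_mul_transvection {i j : ι} (hij : i ≠ j) {a : F} (ha : a ≠ 0) :
    diag2n hij a ha = transvection hij a * transvection hij.symm (-a⁻¹) * transvection hij a *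
      transvection hij (-1) * transvection hij.symm 1 * transvection hij (-1) := by
  refine Subtype.ext ?_
  rw [diag2n_eq_one_add]
  simp only [Matrix.SpecialLinearGroup.coe_mul, transvection_coe, mul_add, add_mul, mul_one,
    one_mul, ne_eq, hij, hij.symm, not_false_eq_true, single_mul_single_same,
    single_mul_single_of_ne, sub_eq_add_neg, single_add, ← single_neg, mul_neg, neg_mul, ha,
    mul_inv_cancel₀, inv_mul_cancel₀, add_zero, neg_zero]
  abel

lemma eq_top_of_transvection_mem [Nontrivial ι] {H : Subgroup (SpecialLinearGroup ι F)}
    (h : ∀ {i j : ι} (hij : i ≠ j) (b : F), transvection hij b ∈ H) : H = ⊤ := by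
  refine (Subgroup.eq_top_iff' H).2 fun A ↦ ?_
  induction A using diagonal_transvection_induction' with
  | hdiag i j hij hc =>
    rw [diag2n_eq_mul_transvection]
    exact mul_mem (mul_mem (mul_mem (mul_mem (mul_mem (h _ _) (h _ _)) (h _ _)) (h _ _)) (h _ _))
      (h _ _)
  | htransvec i j hij a => exact h hij a
  | hmul A B hA hB => exact mul_mem hA hB

lemma commutator_transvection_transvection {i j k : ι} (hij : i ≠ j) (hik : i ≠ k) (hkj : k ≠ j)
    (b : R) : ⁅transvection hik b, transvection hkj (1 : R)⁆ = transvection hij b := by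
  rw [commutatorElement_def, transvection_inv, transvection_inv]
  refine Subtype.ext ?_
  simp only [Matrix.SpecialLinearGroup.coe_mul, transvection_coe, mul_add, add_mul, mul_one,
    one_mul, ne_eq, hij.symm, hik.symm, hkj.symm, not_false_eq_true, single_mul_single_same,
    single_mul_single_of_ne, ← single_neg, mul_neg, neg_mul, add_zero, add_neg_cancel_right]
  abel

lemma commutator_diag2n_transvection {i j : ι} (hij : i ≠ j) {a : F} (ha : a ≠ 0) (b : F) :
    ⁅diag2n hij a ha, transvection hij b⁆ = transvection hij ((a ^ 2 - 1) * b) := by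
  have hcomm : diag2n hij a ha * transvection hij b =
      transvection hij (a ^ 2 * b) * diag2n hij a ha := by
    refine Subtype.ext ?_
    have hb : a * b = a ^ 2 * b * a⁻¹ := by field_simp
    simp [diag2n_coe, transvection_coe, mul_add, add_mul, diagonal_mul_single,
      single_mul_diagonal, hij.symm, hb]
  rw [commutatorElement_def, hcomm, transvection_inv, mul_inv_cancel_right, ← transvection_add]
  ring_nf

lemma commutator_specialLinearGroup_eq_top [Nontrivial ι]
    (h : 3 ≤ Fintype.card ι ∨ ∃ a : F, a ≠ 0 ∧ a ^ 2 ≠ 1) :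
    commutator (SpecialLinearGroup ι F) = ⊤ := by
  have hmem (A B : SpecialLinearGroup ι F) : ⁅A, B⁆ ∈ commutator (SpecialLinearGroup ι F) :=
    Subgroup.commutator_mem_commutator (Subgroup.mem_top A) (Subgroup.mem_top B)
  refine eq_top_of_transvection_mem fun {i j} hij b ↦ ?_
  rcases h with hι | ⟨a, ha, ha2⟩
  · have hlt : Finset.card {i, j} < (Finset.univ : Finset ι).card :=
      Finset.card_le_two.trans_lt (by rwa [Finset.card_univ])
    obtain ⟨k, -, hk⟩ := Finset.exists_mem_notMem_of_card_lt_card hlt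
    obtain ⟨hki, hkj⟩ : k ≠ i ∧ k ≠ j := by simpa using hk
    rw [← commutator_transvection_transvection hij hki.symm hkj]
    exact hmem _ _
  · rw [← mul_div_cancel₀ b (sub_ne_zero.2 ha2), ← commutator_diag2n_transvection hij ha]
    exact hmem _ _

/-- The Iwasawa structure on the projective space of `ι → F` that attaches to each line the
unipotent radical of its stabilizer in the special linear group. -/
def unipotentIwasawa [Nontrivial ι] :
    MulAction.IwasawaStructure (SpecialLinearGroup ι F) (ℙ F (ι → F)) where
  T p := lineStab p.submodule
  is_comm p := by
    rw [← p.mk_rep, Projectivization.submodule_mk]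
    exact lineStab_isMulCommutative_of_span p.rep p.rep_nonzero
  is_conj g p := by rw [PSL.smul_submodule, lineStab_smul]
  is_generator := eq_top_of_transvection_mem fun {i j} hij b ↦
    Subgroup.mem_iSup_of_mem (.mk F (Pi.single i 1) (Pi.single_ne_zero_iff.2 one_ne_zero)) <| by
      rw [Projectivization.submodule_mk]
      exact SL2Gen.transvection_mem_lineStab hij b

theorem eq_top_of_normal_of_not_le_center [Nontrivial ι]
    (h : 3 ≤ Fintype.card ι ∨ ∃ a : F, a ≠ 0 ∧ a ^ 2 ≠ 1)
    {N : Subgroup (SpecialLinearGroup ι F)} [N.Normal] (hN : ¬ N ≤ Subgroup.center _) :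
    N = ⊤ := by
  refine top_le_iff.1 ((commutator_specialLinearGroup_eq_top h).ge.trans
    (unipotentIwasawa.commutator_le N fun hfix ↦ hN fun x hx ↦ ?_))
  rw [← Projectivization.SL_mulAction_ker, MonoidHom.mem_ker]
  ext p : 1
  exact Set.eq_univ_iff_forall.1 hfix p ⟨x, hx⟩

end SpecialLinearGroup

section SLEquiv

variable {ι R F : Type*} [Fintype ι] [DecidableEq ι] [CommRing R] [Field F]

/-- Equivalence of square matrices under multiplication by the special linear group on the left
and on the right. -/
def SLEquiv (X Y : Matrix ι ι R) : Prop :=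
  ∃ x y : SpecialLinearGroup ι R, x.1 * X * y.1 = Y

lemma SLEquiv.symm {X Y : Matrix ι ι R} (h : SLEquiv X Y) : SLEquiv Y X := by
  obtain ⟨x, y, rfl⟩ := h
  have hx : x⁻¹.1 * x.1 = 1 := congrArg Subtype.val (inv_mul_cancel x)
  have hy : y.1 * y⁻¹.1 = 1 := congrArg Subtype.val (mul_inv_cancel y)
  exact ⟨x⁻¹, y⁻¹, by rw [mul_assoc, mul_assoc, hy, mul_one, ← mul_assoc, hx, one_mul]⟩

lemma SLEquiv.trans {X Y Z : Matrix ι ι R} (hXY : SLEquiv X Y) (hYZ : SLEquiv Y Z) :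
    SLEquiv X Z := by
  obtain ⟨x, y, rfl⟩ := hXY
  obtain ⟨x', y', rfl⟩ := hYZ
  exact ⟨x' * x, y * y', by simp only [Matrix.SpecialLinearGroup.coe_mul, mul_assoc]⟩

lemma exists_slEquiv_diagonal (X : Matrix ι ι F) : ∃ D : ι → F, SLEquiv X (diagonal D) := by
  obtain ⟨L, L', D, hX⟩ := Pivot.exists_list_transvec_mul_diagonal_mul_list_transvec X
  have hprod (L : List (TransvectionStruct ι F)) :
      (L.map TransvectionStruct.toSpecialLinearGroup).prod.1 =
        (L.map TransvectionStruct.toMatrix).prod := by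
    rw [← coeMonoidHom_apply, map_list_prod, List.map_map]
    rfl
  exact ⟨D, .symm ⟨(L.map TransvectionStruct.toSpecialLinearGroup).prod,
    (L'.map TransvectionStruct.toSpecialLinearGroup).prod, by rw [hprod, hprod, hX]⟩⟩

lemma slEquiv_diagonal_update (D : ι → F) (b : ι) :
    ∃ t, SLEquiv (diagonal D) (diagonal (Function.update (D * D⁻¹) b t)) := by
  classical
  set u : ι → F := fun i ↦ if D i = 0 then 1 else (D i)⁻¹ with hu
  have hu0 (i : ι) : u i ≠ 0 := by grind
  set c := ∏ i ∈ Finset.univ \ {b}, u i with hc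
  have hc0 : c ≠ 0 := Finset.prod_ne_zero_iff.2 fun i _ ↦ hu0 i
  have hdet : (diagonal (Function.update u b c⁻¹)).det = 1 := by
    rw [det_diagonal, Finset.prod_update_of_mem (Finset.mem_univ b), inv_mul_cancel₀ hc0]
  refine ⟨c⁻¹ * D b, ⟨_, hdet⟩, 1, ?_⟩
  rw [Matrix.SpecialLinearGroup.coe_one, mul_one, diagonal_mul_diagonal]
  congr 1
  ext i
  rcases eq_or_ne i b with rfl | hi
  · simp
  · by_cases h0 : D i = 0 <;> simp [hi, hu, h0]

lemma isIdempotentElem_mul_inv {α G : Type*} [GroupWithZero G] (D : α → G) :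
    IsIdempotentElem (D * D⁻¹) := by
  ext i
  by_cases h0 : D i = 0 <;> simp [h0]

lemma slEquiv_diagonal_add_of_isIdempotentElem {f : ι → R} {a b : ι} (hab : a ≠ b)
    (ha : f a = 1) (hf : IsIdempotentElem f) (t : R) :
    ∃ E E' : Matrix ι ι R, IsIdempotentElem E ∧ IsIdempotentElem E' ∧
      SLEquiv (diagonal (Function.update f b t)) (E + E') := by
  have hf0 : IsIdempotentElem (diagonal (Function.update f b 0)) := by
    rw [IsIdempotentElem, diagonal_mul_diagonal]
    congr 1
    ext i
    rcases eq_or_ne i b with rfl | hi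
    · simp
    · simpa [hi] using congrFun hf i
  have hft : diagonal (Function.update f b t) =
      diagonal (Function.update f b 0) + single b b t := by
    ext i j
    simp only [diagonal_apply, Matrix.add_apply, single_apply, Function.update_apply]
    grind
  -- In rows and columns `a`, `b`:
  -- `[[1,0],[0,t]] ~ [[1,1],[1-t,1]] = [[1,1],[0,0]] + [[0,0],[1-t,1]]`.
  refine ⟨diagonal (Function.update f b 0) + single a b 1, single b b 1 + single b a (1 - t),
    ?_, ?_, transvection hab.symm (1 - t), transvection hab 1, ?_⟩
  · rw [IsIdempotentElem, mul_add, add_mul, add_mul, hf0]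
    simp [diagonal_mul_single, single_mul_diagonal, hab, hab.symm, ha]
  · simp [IsIdempotentElem, mul_add, add_mul, hab]
  · rw [hft]
    simp only [transvection_coe, sub_eq_add_neg, single_add, ← single_neg, mul_add, add_mul,
      one_mul, mul_one, neg_mul, neg_zero, add_zero, diagonal_mul_single, single_mul_diagonal,
      single_mul_single_same, single_mul_single_of_ne, ne_eq, hab, hab.symm, not_false_eq_true,
      Function.update_of_ne, ha]
    abel

theorem exists_slEquiv_add_isIdempotentElem [Nontrivial ι] (X : Matrix ι ι F) :
    ∃ E E' : Matrix ι ι F, IsIdempotentElem E ∧ IsIdempotentElem E' ∧ SLEquiv X (E + E') := by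
  obtain ⟨D, hXD⟩ := exists_slEquiv_diagonal X
  by_cases hD : D = 0
  · exact ⟨0, 0, .zero, .zero, by simpa [hD] using hXD⟩
  obtain ⟨a, ha⟩ := Function.ne_iff.1 hD
  obtain ⟨b, hb⟩ := exists_ne a
  obtain ⟨t, hDt⟩ := slEquiv_diagonal_update D b
  obtain ⟨E, E', hE, hE', hEE'⟩ := slEquiv_diagonal_add_of_isIdempotentElem
    hb.symm (mul_inv_cancel₀ ha) (isIdempotentElem_mul_inv D) t
  exact ⟨E, E', hE, hE', hXD.trans (hDt.trans hEE')⟩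

lemma diag2n_smul_single {i j : ι} (hij : i ≠ j) {a : F} (ha : a ≠ 0) (c : F) :
    diag2n hij a ha • (Pi.single i c : ι → F) = Pi.single i (a * c) := by
  rw [Matrix.SpecialLinearGroup.smul_def, diag2n_coe]
  simp [← Pi.single_smul]

lemma exists_smul_eq_single [Nontrivial ι] {v : ι → F} (hv : v ≠ 0) (i : ι) :
    ∃ x : SpecialLinearGroup ι F, x • v = Pi.single i 1 := by
  obtain ⟨j, hj⟩ := exists_ne i
  have hi : (Pi.single i 1 : ι → F) ≠ 0 := Pi.single_ne_zero_iff.2 one_ne_zero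
  obtain ⟨x, hx⟩ := MulAction.exists_smul_eq (SpecialLinearGroup ι F)
    (Projectivization.mk F v hv) (Projectivization.mk F (Pi.single i 1) hi)
  rw [Projectivization.smul_mk, Projectivization.mk_eq_mk_iff] at hx
  obtain ⟨c, hc⟩ := hx
  refine ⟨diag2n hj.symm (c⁻¹ : F) (inv_ne_zero c.ne_zero) * x, ?_⟩
  rw [mul_smul, ← hc, Units.smul_def, ← Pi.single_smul, diag2n_smul_single]
  simp

lemma exists_smul_eq_of_ne_zero [Nontrivial ι] {v w : ι → F} (hv : v ≠ 0) (hw : w ≠ 0) :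
    ∃ x : SpecialLinearGroup ι F, x • v = w := by
  obtain ⟨i⟩ := ‹Nontrivial ι›.to_nonempty
  obtain ⟨x, hx⟩ := exists_smul_eq_single hv i
  obtain ⟨y, hy⟩ := exists_smul_eq_single hw i
  exact ⟨y⁻¹ * x, by rw [mul_smul, hx, ← hy, inv_smul_smul]⟩

lemma det_one_add_vecMulVec {u v : ι → R} (h : v ⬝ᵥ u = 0) :
    (1 + vecMulVec u v).det = 1 := by
  rw [vecMulVec_eq Unit, det_one_add_replicateCol_mul_replicateRow, h, add_zero]

theorem exists_slEquiv_diag_eq [Nontrivial ι] {X : Matrix ι ι F} (hX : X ≠ 0) (t : F) :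
    ∃ Y, SLEquiv X Y ∧ ∀ i, Y i i = t := by
  obtain ⟨a, ha⟩ : ∃ a, X.col a ≠ 0 := by
    by_contra! h
    exact hX (Matrix.ext fun i j ↦ congrFun (h j) i)
  obtain ⟨b, hb⟩ := exists_ne a
  set w : ι → F := Function.update 1 a t with hw
  have hw0 : w ≠ 0 := fun h ↦ by simpa [hw, hb] using congrFun h b
  obtain ⟨x, hx⟩ := exists_smul_eq_of_ne_zero ha hw0
  have hcol (i : ι) : (x.1 * X) i a = w i := congrFun hx i
  set v : ι → F := Function.update (fun i ↦ t - (x.1 * X) i i) a 0 with hv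
  have hdet : (1 + vecMulVec (Pi.single a 1) v).det = 1 := det_one_add_vecMulVec (by simp [hv])
  refine ⟨x.1 * X * (1 + vecMulVec (Pi.single a 1) v), ⟨x, ⟨_, hdet⟩, rfl⟩, fun i ↦ ?_⟩
  have hentry : (x.1 * X * (1 + vecMulVec (Pi.single a 1) v)) i i =
      (x.1 * X) i i + w i * v i := by
    rw [mul_add, mul_one, mul_vecMulVec, Matrix.add_apply, vecMulVec_apply, mulVec_single_one,
      col_apply, hcol]
  rw [hentry]
  rcases eq_or_ne i a with rfl | hi
  · simp [hcol, hw, hv]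
  · simp [hw, hv, hi]

end SLEquiv

section Roots

-- Newton's method started at `1`: modulo nilpotents `1` is a root of `X ^ k - u`, and the
-- derivative of this polynomial at `1` is `k`.
open Polynomial in
lemma exists_pow_eq_and_isNilpotent_sub_one {S : Type*} [CommRing S] {k : ℕ}
    (hk : IsUnit (k : S)) {u : S} (hu : IsNilpotent (u - 1)) :
    ∃ v, v ^ k = u ∧ IsNilpotent (v - 1) := by
  obtain ⟨v, ⟨hv, hroot⟩, -⟩ := existsUnique_nilpotent_sub_and_aeval_eq_zero
    (P := X ^ k - C u) (x := (1 : S)) (by simpa using hu.neg) (by simpa [derivative_X_pow] using hk)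
  exact ⟨v, by simpa [sub_eq_zero] using hroot, by simpa using hv.neg⟩

lemma exists_units_pow_eq_of_isNilpotent_sub_one {R A : Type*} [CommRing R] [Ring A] [Algebra R A]
    {k : ℕ} (hk : IsUnit (k : R)) {u : A} (hu : IsNilpotent (u - 1)) :
    ∃ v : Aˣ, (v : A) ^ k = u := by
  let S := Algebra.adjoin R {u}
  have : IsMulCommutative S := Algebra.isMulCommutative_adjoin R (by simp)
  let u' : S := ⟨u, Algebra.self_mem_adjoin_singleton R u⟩
  have hu' : IsNilpotent (u' - 1) :=
    (IsNilpotent.map_iff (f := S.val) Subtype.val_injective).1 (by simpa [u'] using hu)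
  have hkS : IsUnit (k : S) := by simpa using hk.map (algebraMap R S)
  obtain ⟨v, hvk, hv⟩ := exists_pow_eq_and_isNilpotent_sub_one hkS hu'
  have hunit : IsUnit (v : A) := by simpa using (hv.map S.val).isUnit_one_add
  exact ⟨hunit.unit, congrArg S.val hvk⟩

end Roots

section TriangularMatrix

variable {m R : Type*} [Fintype m] [LinearOrder m] [CommRing R] {M : Matrix m m R}

lemma isNilpotent_of_isUpperTriangular (hM : M.IsUpperTriangular) (h0 : ∀ i, M i i = 0) :
    IsNilpotent M := by
  refine ⟨Fintype.card m, ?_⟩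
  have h := aeval_self_charpoly M
  rw [charpoly_of_isUpperTriangular M hM] at h
  simpa [h0] using h

lemma exists_eq_add_of_diag_eq_zero (h0 : ∀ i, M i i = 0) :
    ∃ N N' : Matrix m m R, IsNilpotent N ∧ IsNilpotent N' ∧ M = N + N' := by
  have hupper (M : Matrix m m R) : IsNilpotent (of fun i j ↦ if i < j then M i j else 0) :=
    isNilpotent_of_isUpperTriangular (fun i j (hij : j < i) ↦ by simp [hij.not_gt]) (by simp)
  refine ⟨_, (of fun i j ↦ if i < j then Mᵀ i j else 0)ᵀ, hupper M, ?_, ?_⟩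
  · obtain ⟨r, hr⟩ := hupper Mᵀ
    exact ⟨r, by rw [← transpose_pow, hr, transpose_zero]⟩
  · ext i j
    rcases lt_trichotomy i j with hij | rfl | hij
    · simp [hij, hij.not_gt]
    · simp [h0]
    · simp [hij, hij.not_gt]

end TriangularMatrix

section FiniteField

variable {F : Type*} [Field F]

lemma exists_ne_zero_and_sq_ne_one (h2 : Nat.card F ≠ 2) (h3 : Nat.card F ≠ 3) :
    ∃ a : F, a ≠ 0 ∧ a ^ 2 ≠ 1 := by
  classical
  by_contra! h
  have huniv : (Set.univ : Set F) ⊆ ({0, 1, -1} : Finset F) := fun a _ ↦ by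
    by_cases ha : a = 0
    · simp [ha]
    · simpa [ha] using sq_eq_one_iff.1 (h a ha)
  have : Finite F := Set.finite_univ_iff.1 ((Finset.finite_toSet _).subset huniv)
  have hle : Nat.card F ≤ 3 := by
    rw [← Set.ncard_univ]
    exact (Set.ncard_le_ncard huniv).trans
      (by rw [Set.ncard_coe_finset]; exact Finset.card_le_three)
  have := Finite.one_lt_card (α := F)
  lia

lemma kthPowers_gcd_card_sub_one [Finite F] {k : ℕ} (hk : k ≠ 0) :
    kthPowers (k.gcd (Nat.card F - 1)) F = kthPowers k F := by
  have := Fintype.ofFinite F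
  ext x
  constructor
  · rintro ⟨b, rfl⟩
    rcases eq_or_ne b 0 with rfl | hb
    · exact ⟨0, by rw [zero_pow hk, zero_pow (Nat.gcd_ne_zero_left hk)]⟩
    have hb1 : b ^ (Nat.card F - 1) = 1 := by
      rw [Nat.card_eq_fintype_card, FiniteField.pow_card_sub_one_eq_one b hb]
    refine ⟨b ^ k.gcdA (Nat.card F - 1), ?_⟩
    calc b ^ k.gcd (Nat.card F - 1)
        = b ^ (k * k.gcdA (Nat.card F - 1) +
            (Nat.card F - 1 : ℕ) * k.gcdB (Nat.card F - 1)) := by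
          rw [← Nat.gcd_eq_gcd_ab, zpow_natCast]
      _ = (b ^ k.gcdA (Nat.card F - 1)) ^ k := by
          rw [zpow_add₀ hb, _root_.zpow_mul b (Nat.card F - 1 : ℕ), zpow_natCast, hb1,
            _root_.one_zpow, mul_one, mul_comm, _root_.zpow_mul, zpow_natCast]
  · rintro ⟨b, rfl⟩
    obtain ⟨c, hc⟩ := Nat.gcd_dvd_left k (Nat.card F - 1)
    exact ⟨b ^ c, by rw [← pow_mul, mul_comm, ← hc]⟩

end FiniteField

section Stabilizer

variable {n k : ℕ} {F : Type*} [Field F] {S : Set (Matrix (Fin n) (Fin n) F)}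

lemma mem_leftStabilizer_iff {g : GL (Fin n) F} :
    g ∈ leftStabilizer S ↔ ∀ A, g.1 * A ∈ S ↔ A ∈ S := by
  have himage : (fun A ↦ g.1 * A) '' S = (fun A ↦ g⁻¹.1 * A) ⁻¹' S :=
    (Units.mulLeft g).image_eq_preimage_symm S
  change _ '' S = S ↔ _
  rw [himage, Set.ext_iff, ← (Units.mulLeft g).forall_congr_right]
  simp [iff_comm]

lemma mem_leftStabilizer_of_union_zero (h : S ∪ {0} = Set.univ) (g : GL (Fin n) F) :
    g ∈ leftStabilizer S := by
  have hmem {A : Matrix (Fin n) (Fin n) F} (hA : A ≠ 0) : A ∈ S :=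
    (Set.eq_univ_iff_forall.1 h A).resolve_right hA
  refine mem_leftStabilizer_iff.2 fun A ↦ ?_
  rcases eq_or_ne A 0 with rfl | hA
  · rw [mul_zero]
  · exact iff_of_true (hmem (mt g.isUnit.mul_right_eq_zero.1 hA)) (hmem hA)

/-- Stability of a set of matrices under conjugation by invertible matrices. -/
def ConjInvariant (S : Set (Matrix (Fin n) (Fin n) F)) : Prop :=
  ∀ (u : GL (Fin n) F), ∀ A ∈ S, u.1 * A * u⁻¹.1 ∈ S

lemma ConjInvariant.mem_iff (hS : ConjInvariant S) (u : GL (Fin n) F)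
    (A : Matrix (Fin n) (Fin n) F) : u.1 * A * u⁻¹.1 ∈ S ↔ A ∈ S := by
  refine ⟨fun h ↦ ?_, hS u A⟩
  have h' := hS u⁻¹ _ h
  rwa [inv_inv, mul_assoc u.1, Units.inv_mul_cancel_left, mul_assoc, Units.inv_mul, mul_one] at h'

lemma ConjInvariant.normal_leftStabilizer (hS : ConjInvariant S) : (leftStabilizer S).Normal where
  conj_mem g hg u := by
    rw [mem_leftStabilizer_iff] at hg ⊢
    intro A
    rw [← hS.mem_iff u⁻¹, ← hS.mem_iff u⁻¹ A, ← hg (_ * A * _)]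
    simp [mul_assoc]

lemma conjInvariant_sumPowers : ConjInvariant (sumPowers k n F) := by
  rintro u _ ⟨A, B, rfl⟩
  exact ⟨u.1 * A * u⁻¹.1, u.1 * B * u⁻¹.1, by
    rw [Units.conj_pow, Units.conj_pow, mul_add, add_mul]⟩

lemma conjInvariant_sumUnitPowers : ConjInvariant (sumUnitPowers k n F) := by
  rintro u _ ⟨A, B, rfl⟩
  exact ⟨u * A * u⁻¹, u * B * u⁻¹, by
    simp only [Units.val_mul, Units.conj_pow, mul_add, add_mul]⟩

lemma ConjInvariant.mem_iff_of_slEquiv (hS : ConjInvariant S)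
    (hSL : ∀ x : SpecialLinearGroup (Fin n) F, toGL x ∈ leftStabilizer S)
    {X Y : Matrix (Fin n) (Fin n) F} (hXY : SLEquiv X Y) : X ∈ S ↔ Y ∈ S := by
  obtain ⟨x, y, rfl⟩ := hXY
  have hmem (z : SpecialLinearGroup (Fin n) F) (A : Matrix (Fin n) (Fin n) F) :
      z.1 * A ∈ S ↔ A ∈ S := mem_leftStabilizer_iff.1 (hSL z) A
  have hconj : (toGL y).1 * (X * y.1) * (toGL y)⁻¹.1 = y.1 * X := by
    rw [← mul_assoc]
    exact Units.mul_inv_cancel_right _ (toGL y)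
  rw [mul_assoc, hmem, ← hS.mem_iff (toGL y) (X * y.1), hconj, hmem]

lemma nontrivial_of_notMem_center {g : SpecialLinearGroup (Fin n) F} (hg : g ∉ Subgroup.center _) :
    Nontrivial (Fin n) := by
  by_contra h
  have := not_nontrivial_iff_subsingleton.1 h
  exact hg (Subsingleton.elim g 1 ▸ one_mem _)

lemma ConjInvariant.toGL_mem_leftStabilizer (hS : ConjInvariant S)
    (hnF : (n, Nat.card F) ≠ (2, 2) ∧ (n, Nat.card F) ≠ (2, 3))
    {g : SpecialLinearGroup (Fin n) F} (hg : g ∉ Subgroup.center _)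
    (hgS : toGL g ∈ leftStabilizer S) (x : SpecialLinearGroup (Fin n) F) :
    toGL x ∈ leftStabilizer S := by
  have := nontrivial_of_notMem_center hg
  have hn : 2 ≤ n := Fin.nontrivial_iff_two_le.1 this
  have hcase : 3 ≤ Fintype.card (Fin n) ∨ ∃ a : F, a ≠ 0 ∧ a ^ 2 ≠ 1 := by
    rw [Fintype.card_fin, or_iff_not_imp_left]
    intro h3
    obtain rfl : n = 2 := by lia
    exact exists_ne_zero_and_sq_ne_one (by simpa using hnF.1) (by simpa using hnF.2)
  have := hS.normal_leftStabilizer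
  have htop : (leftStabilizer S).comap toGL = ⊤ :=
    eq_top_of_normal_of_not_le_center hcase fun h ↦ hg (h hgS)
  exact Subgroup.mem_comap.1 (htop ▸ Subgroup.mem_top x)

end Stabilizer

section Waring

variable {n k : ℕ} {F : Type*} [Field F]

theorem sumPowers_eq_univ [Nontrivial (Fin n)] (hk : k ≠ 0)
    (hSL : ∀ X Y, SLEquiv X Y → (X ∈ sumPowers k n F ↔ Y ∈ sumPowers k n F)) :
    sumPowers k n F = Set.univ := by
  refine Set.eq_univ_of_forall fun X ↦ ?_
  obtain ⟨E, E', hE, hE', hX⟩ := exists_slEquiv_add_isIdempotentElem X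
  exact (hSL _ _ hX).2 ⟨E, E', by rw [hE.pow_eq hk, hE'.pow_eq hk]⟩

lemma mem_sumUnitPowers_of_diag_eq_two (hk : (k : F) ≠ 0) {X : Matrix (Fin n) (Fin n) F}
    (hX : ∀ i, X i i = 2) : X ∈ sumUnitPowers k n F := by
  obtain ⟨N, N', hN, hN', hXN⟩ :=
    exists_eq_add_of_diag_eq_zero (M := X - 2) fun i ↦ by simp [hX, ofNat_apply]
  obtain ⟨U, hU⟩ := exists_units_pow_eq_of_isNilpotent_sub_one hk.isUnit
    (u := 1 + N) (by rwa [add_sub_cancel_left])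
  obtain ⟨V, hV⟩ := exists_units_pow_eq_of_isNilpotent_sub_one hk.isUnit
    (u := 1 + N') (by rwa [add_sub_cancel_left])
  refine ⟨U, V, ?_⟩
  rw [hU, hV, add_add_add_comm, ← hXN, one_add_one_eq_two, add_sub_cancel]

theorem sumUnitPowers_union_eq_univ [Nontrivial (Fin n)] (hk : (k : F) ≠ 0)
    (hSL : ∀ X Y, SLEquiv X Y → (X ∈ sumUnitPowers k n F ↔ Y ∈ sumUnitPowers k n F)) :
    sumUnitPowers k n F ∪ {0} = Set.univ := by
  refine Set.eq_univ_of_forall fun X ↦ or_iff_not_imp_right.2 fun hX ↦ ?_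
  obtain ⟨Y, hXY, hY⟩ := exists_slEquiv_diag_eq hX 2
  exact (hSL X Y hXY).2 (mem_sumUnitPowers_of_diag_eq_two hk hY)

lemma zero_mem_sumUnitPowers (hk : k ≠ 0) (h : (-1 : F) ∈ kthPowers k F) :
    0 ∈ sumUnitPowers k n F := by
  obtain ⟨a, ha⟩ := h
  have ha0 : a ≠ 0 := by
    rintro rfl
    simp [zero_pow hk] at ha
  refine ⟨1, GeneralLinearGroup.scalar (Fin n) (Units.mk0 a ha0), ?_⟩
  change 0 = 1 ^ k + scalar (Fin n) a ^ k
  rw [_root_.one_pow, ← map_pow, ← ha, map_neg, map_one, add_neg_cancel]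

end Waring

end MatrixWaring

open MatrixWaring in
theorem theorem1p1_general {F : Type*} [Field F] {k n : ℕ} (hk : k ≠ 0)
    (hnF : (n, Nat.card F) ≠ (2, 2) ∧ (n, Nat.card F) ≠ (2, 3))
    {g : Matrix.SpecialLinearGroup (Fin n) F} (hg : g ∉ Subgroup.center _) :
    (sumPowers k n F = Set.univ ↔
      (g : Matrix.GeneralLinearGroup (Fin n) F) ∈ leftStabilizer (sumPowers k n F)) ∧
    ((k : F) ≠ 0 → (-1 : F) ∈ kthPowers k F →
      (sumUnitPowers k n F = Set.univ ↔
        (g : Matrix.GeneralLinearGroup (Fin n) F) ∈ leftStabilizer (sumUnitPowers k n F))) ∧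
    ((k : F) ≠ 0 →
      (sumUnitPowers k n F ∪ {0} = Set.univ ↔
        (g : Matrix.GeneralLinearGroup (Fin n) F) ∈ leftStabilizer (sumUnitPowers k n F))) := by
  have := nontrivial_of_notMem_center hg
  have hP (h : (g : Matrix.GeneralLinearGroup (Fin n) F) ∈ leftStabilizer (sumPowers k n F)) :
      sumPowers k n F = Set.univ :=
    sumPowers_eq_univ hk fun _ _ ↦ conjInvariant_sumPowers.mem_iff_of_slEquiv
      (conjInvariant_sumPowers.toGL_mem_leftStabilizer hnF hg h)
  have hQ (hkF : (k : F) ≠ 0)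
      (h : (g : Matrix.GeneralLinearGroup (Fin n) F) ∈ leftStabilizer (sumUnitPowers k n F)) :
      sumUnitPowers k n F ∪ {0} = Set.univ :=
    sumUnitPowers_union_eq_univ hkF fun _ _ ↦ conjInvariant_sumUnitPowers.mem_iff_of_slEquiv
      (conjInvariant_sumUnitPowers.toGL_mem_leftStabilizer hnF hg h)
  refine ⟨⟨fun h ↦ mem_leftStabilizer_of_union_zero (by simp [h]) _, hP⟩,
    fun hkF h1 ↦ ⟨fun h ↦ mem_leftStabilizer_of_union_zero (by simp [h]) _, fun h ↦ ?_⟩,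
    fun hkF ↦ ⟨fun h ↦ mem_leftStabilizer_of_union_zero h _, hQ hkF⟩⟩
  rw [← hQ hkF h, eq_comm, Set.union_eq_left, Set.singleton_subset_iff]
  exact zero_mem_sumUnitPowers hk h1

theorem theorem1p1 {F : Type*} [Field F] [Finite F] (p l q k n : ℕ)
    (hp : p.Prime) (hl : 1 ≤ l) (hq : q = p ^ l) (hF : Nat.card F = q)
    (hk : 1 ≤ k) (hn : 2 ≤ n)
    (hnq : (n, q) ≠ (2, 2) ∧ (n, q) ≠ (2, 3))
    (g : Matrix.SpecialLinearGroup (Fin n) F)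
    (hg : g ∉ Subgroup.center (Matrix.SpecialLinearGroup (Fin n) F)) :
    (MatrixWaring.sumPowers k n F = Set.univ ↔
      (g : Matrix.GeneralLinearGroup (Fin n) F) ∈
        MatrixWaring.leftStabilizer (MatrixWaring.sumPowers k n F)) ∧
    (¬ p ∣ k → (-1 : F) ∈ MatrixWaring.kthPowers (Nat.gcd k (q - 1)) F →
      (MatrixWaring.sumUnitPowers k n F = Set.univ ↔
        (g : Matrix.GeneralLinearGroup (Fin n) F) ∈
          MatrixWaring.leftStabilizer (MatrixWaring.sumUnitPowers k n F))) ∧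
    (¬ p ∣ k →
      (MatrixWaring.sumUnitPowers k n F ∪ {0} = Set.univ ↔
        (g : Matrix.GeneralLinearGroup (Fin n) F) ∈
          MatrixWaring.leftStabilizer (MatrixWaring.sumUnitPowers k n F))) := by
  subst hF
  have : Fact p.Prime := ⟨hp⟩
  have : Fintype F := Fintype.ofFinite F
  have : CharP F p := charP_of_card_eq_prime_pow (f := l) (by rw [← Nat.card_eq_fintype_card, hq])
  rw [MatrixWaring.kthPowers_gcd_card_sub_one (by lia), ← CharP.cast_eq_zero_iff F p k]
  exact theorem1p1_general (by lia) hnq hg
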